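/- Consider $N$ queues sharing one server in slotted time. The numbers of arrivals $A_j(t)$ to queue $j$ at slot boundaries are independent over $j$ and $t$, Bernoulli with rate $\lambda_j$, and $\Lambda=\{\lambda\in\mathbb R_+^N:\sum_j\lambda_j<1\}$. In each slot $t$ the scheduler places the server at one queue $u_t$, where it either serves one packet (if the queue is nonempty) or idles, so that $Q_j(t+1)=(Q_j(t)-D_j(t))^++A_j(t+1)$, with $D_j(t)=1$ if queue $j$ is served in slot $t$ and $0$ otherwise. At the beginning of slot $t$ the scheduler knows the incumbent $u_{t-1}$, the vector $V(t)=(V_j(t))_j$ of the numbers of slots since the server was last placed at each queue (so $V_j(t)=0$ exactly for $j=u_{t-1}$), and the last observed backlogs $Q_j(t-V_j(t))$, which include the current backlog of the incumbent. A stationary Markov policy is a deterministic, time-independent map from this information to actions. It is greedy if it never idles at a nonempty incumbent, and exhaustive if it never switches away from a nonempty incumbent. Cyclic exhaustive service is the greedy exhaustive policy that, when the incumbent is empty, serves a queue $j$ with the largest $V_j(t)$ (ties broken arbitrarily). A policy stabilizes $\lambda$ if the controlled Markov chain formed by the backlogs $Q(t)$ and the scheduler's information enters, from every initial state (with $Q_j(t-V_j(t))\le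 Q_j(t)\le Q_j(t-V_j(t))+V_j(t)$ for all $j$), the set of positive recurrent states with probability one; it is throughput optimal if it stabilizes every $\lambda\in\Lambda$. Then: 1. Cyclic exhaustive service is throughput optimal. 2. Every greedy exhaustive stationary Markov policy that deviates from cyclic exhaustive service only when $V(t)$ lies in some finite set $S'\subset\mathbb N^N$ is throughput optimal. 3. If $N\ge 2$, the class of throughput-optimal stationary Markov policies is not a singleton. Moreover, for every $\lambda\in\Lambda$ and every initial state, the throughput-optimal greedy exhaustive stationary Markov policies induce infinitely many different processes (already as families of one-time marginal laws). -/

import Mathlib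

open scoped NNReal ENNReal Topology

/-! ## Stability of a countable Markov chain -/

namespace MarkovChain

/-- `survival P A n x` is the probability that the Markov chain with transition law `P` started
at `x` avoids `A` at all of the times `1, …, n`, i.e. `ℙₓ(τ_A > n)`, where
`τ_A = inf {m ≥ 1 | X_m ∈ A}`. -/
noncomputable def survival {X : Type*} (P : X → PMF X) (A : Set X) : ℕ → X → ℝ≥0∞
  | 0, _ => 1
  | n + 1, x => ∑' y, P x y * Aᶜ.indicator (survival P A n) y

/-- `𝔼ₓ[τ_A] = ∑ₙ ℙₓ(τ_A > n)`. -/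
noncomputable def meanReturnTime {X : Type*} (P : X → PMF X) (A : Set X) (x : X) : ℝ≥0∞ :=
  ∑' n, survival P A n x

/-- The set of positive recurrent states: those whose mean return time is finite. -/
def positiveRecurrentStates {X : Type*} (P : X → PMF X) : Set X :=
  {y | meanReturnTime P {y} y < ∞}

/-- Stability of a (possibly reducible) chain: from every initial state, the chain almost surely
enters the set of positive recurrent states.  Equivalently, all recurrent classes are positive
recurrent, and no trajectory stays among the transient states for ever.  For an irreducible chain
this is positive recurrence. -/
def IsStable {X : Type*} (P : X → PMF X) : Prop :=
  ∀ x, Filter.Tendsto (fun n => survival P (positiveRecurrentStates P) n x) Filter.atTop (𝓝 0)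

/-- The law at time `t` of the chain started at `x`. -/
noncomputable def law {X : Type*} (P : X → PMF X) (x : X) : ℕ → PMF X
  | 0 => PMF.pure x
  | t + 1 => (law P x t).bind P

end MarkovChain

/-! ## The polling system -/

namespace Polling

/-- The arrival rate vectors `lam ≥ 0` with `∑ lam_j < 1`. -/
def capacityRegion (N : ℕ) : Set (Fin N → ℝ≥0) := {lam | ∑ j, lam j < 1}

theorem capacityRegion.le_one {N : ℕ} (lam : capacityRegion N) (j : Fin N) : lam.1 j ≤ 1 :=
  (Finset.single_le_sum (f := lam.1) (fun _ _ => zero_le) (Finset.mem_univ j)).trans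
    (le_of_lt lam.2)

/-- The joint law of the arrivals at one slot boundary: independent over the queues,
Bernoulli(`lam j`) at queue `j`. -/
noncomputable def arrivals {N : ℕ} (lam : capacityRegion N) : PMF (Fin N → Bool) :=
  PMF.ofFintype (fun a => ∏ j, if a j then (lam.1 j : ℝ≥0∞) else ((1 - lam.1 j : ℝ≥0) : ℝ≥0∞)) <| by
    have h := Finset.prod_univ_sum (fun _ : Fin N => (Finset.univ : Finset Bool))
      (fun j b => if b then (lam.1 j : ℝ≥0∞) else ((1 - lam.1 j : ℝ≥0) : ℝ≥0∞))
    rw [Fintype.piFinset_univ] at h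
    rw [← h]
    refine Finset.prod_eq_one fun j _ => ?_
    have := add_tsub_cancel_of_le (capacityRegion.le_one lam j)
    simp only [Fintype.sum_bool, if_true, Bool.false_eq_true, if_false]
    exact_mod_cast this

/-- What the scheduler knows at the beginning of slot `t`. -/
structure Info (N : ℕ) where
  /-- the queue scheduled in slot `t - 1` -/
  incumbent : Fin N
  /-- `V_j(t)`, the number of slots since queue `j` was last scheduled -/
  age : Fin N → ℕ
  /-- `Q_j(t - V_j(t))`, the last observed backlog of queue `j`; for the incumbent this is its
  current backlog -/
  obs : Fin N → ℕ
  age_eq_zero_iff : ∀ j, age j = 0 ↔ j = incumbent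

/-- The state of the system: the backlogs `Q_j(t)` and the information of the scheduler.  A queue
that was last observed `V_j` slots ago has since then received at most one packet per slot and has
not been served. -/
structure State (N : ℕ) where
  backlog : Fin N → ℕ
  info : Info N
  obs_le : ∀ j, info.obs j ≤ backlog j
  le_obs_add_age : ∀ j, backlog j ≤ info.obs j + info.age j

/-- An action: the queue at which the server is placed in this slot, and whether it serves that
queue (if nonempty) or idles there. -/
structure Action (N : ℕ) where
  queue : Fin N
  serve : Bool

/-- A (deterministic) stationary Markov policy. -/
abbrev Policy (N : ℕ) := Info N → Action N

/-- The backlogs at the beginning of the next slot: `Q_j(t+1) = (Q_j(t) - D_j(t))⁺ + A_j(t+1)`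
(truncated subtraction of natural numbers). -/
def nextBacklog {N : ℕ} (Q : Fin N → ℕ) (u : Action N) (a : Fin N → Bool) (j : Fin N) : ℕ :=
  (Q j - if u.serve = true ∧ j = u.queue then 1 else 0) + if a j = true then 1 else 0

/-- The state at the beginning of the next slot, given the action and the arrivals. -/
def State.next {N : ℕ} (x : State N) (u : Action N) (a : Fin N → Bool) : State N where
  backlog := nextBacklog x.backlog u a
  info :=
    { incumbent := u.queue
      age := fun j => if j = u.queue then 0 else x.info.age j + 1
      obs := fun j => if j = u.queue then nextBacklog x.backlog u a j else x.info.obs j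
      age_eq_zero_iff := fun j => by by_cases h : j = u.queue <;> simp [h] }
  obs_le := fun j => by
    have := x.obs_le j
    by_cases h : j = u.queue
    · simp [h]
    · simp only [h, if_false, nextBacklog, and_false]; omega
  le_obs_add_age := fun j => by
    have := x.le_obs_add_age j
    by_cases h : j = u.queue
    · simp [h]
    · simp only [h, if_false, nextBacklog, and_false]; split_ifs <;> omega

/-- The transition law of the system under the policy `φ` with arrival rates `lam`. -/
noncomputable def transition {N : ℕ} (lam : capacityRegion N) (φ : Policy N) (x : State N) :
    PMF (State N) :=
  (arrivals lam).map (x.next (φ x.info))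

/-- The policy stabilizes the system for every arrival rate vector in the capacity region. -/
def IsThroughputOptimal {N : ℕ} (φ : Policy N) : Prop :=
  ∀ lam : capacityRegion N, MarkovChain.IsStable (transition lam φ)

/-- The server never idles at a nonempty incumbent. -/
def IsGreedy {N : ℕ} (φ : Policy N) : Prop :=
  ∀ i : Info N, 0 < i.obs i.incumbent → ¬((φ i).queue = i.incumbent ∧ (φ i).serve = false)

/-- The server never switches away from a nonempty incumbent. -/
def IsExhaustive {N : ℕ} (φ : Policy N) : Prop :=
  ∀ i : Info N, 0 < i.obs i.incumbent → (φ i).queue = i.incumbent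

/-- Cyclic exhaustive service: the incumbent is served while it is nonempty; when it is empty, a
queue that has not been scheduled for the longest time is served (ties between the ages, which can
only come from the initial state, are broken in any way). -/
def IsCyclicExhaustive {N : ℕ} (φ : Policy N) : Prop :=
  IsGreedy φ ∧ IsExhaustive φ ∧
    ∀ i : Info N, i.obs i.incumbent = 0 →
      (φ i).serve = true ∧ ∀ j, i.age j ≤ i.age (φ i).queue

/-- The age vectors at which the policy `φ` deviates from the policy `ψ`. -/
def deviationSet {N : ℕ} (φ ψ : Policy N) : Set (Fin N → ℕ) :=
  {v | ∃ i : Info N, i.age = v ∧ φ i ≠ ψ i}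

end Polling

/-! Stability follows from Foster's criterion with `potential L`: `L` times the total backlog plus
the sum of the ages truncated at `L`. In one slot the ages contribute an increase of at most `N`,
and arrivals add `L * ρ` on average, where `ρ = ∑ j, lam j < 1`. Serving a nonempty queue removes
`L` from the first term; moving to a queue of age at least `L` removes `L` from the second, even if
that queue turns out to be empty. For `L` large the drift is at most `-1` (`drift`). The only
exceptions have an empty incumbent and all ages at most `L`. Whatever a policy does at finitely many
age vectors falls among these exceptions once `L` is large.

Exhaustive service leaves a queue only when it is empty, so observed backlogs of non-incumbents
never exceed their initial maximum. On this absorbing set the exceptional states are finite in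
number, hence have finite mean return times.

The chain may be reducible, so this must be turned into almost sure entry into the positive
recurrent states (`isStable_of_finite_meanReturnTime`): every absorbing subset contains a positive
recurrent state, and a maximum principle then rules out positive probability of avoiding them.

For non-uniqueness, policies that linger at an empty incumbent until some age exceeds `m` deviate
from cyclic service in a finite box only. Different large thresholds `m` are told apart by the first
time at which the server can be elsewhere. -/

namespace MarkovChain

/-! ### Taboo operator, truncated return times and Foster's criterion -/

variable {X : Type*} {P : X → PMF X} {A F Y : Set X}

/-- The transition operator of the chain killed on entering `A`. -/
noncomputable def taboo (P : X → PMF X) (A : Set X) (g : X → ℝ≥0∞) (x : X) : ℝ≥0∞ :=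
  ∑' y, P x y * Aᶜ.indicator g y

/-- A set that the chain cannot leave. -/
def Absorbing (P : X → PMF X) (Y : Set X) : Prop :=
  ∀ x ∈ Y, ∀ y, P x y ≠ 0 → y ∈ Y

theorem survival_succ (P : X → PMF X) (A : Set X) (n : ℕ) :
    survival P A (n + 1) = taboo P A (survival P A n) := rfl

theorem taboo_le_tsum {x : X} {g g' : X → ℝ≥0∞}
    (h : ∀ y, P x y ≠ 0 → y ∉ A → g y ≤ g' y) :
    taboo P A g x ≤ ∑' y, P x y * g' y := by
  refine ENNReal.tsum_le_tsum fun y => ?_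
  by_cases hy : P x y = 0
  · simp [hy]
  by_cases hA : y ∈ A
  · simp [hA]
  · rw [Set.indicator_of_mem (by simpa using hA)]
    gcongr
    exact h y hy hA

theorem taboo_mono {x : X} {g g' : X → ℝ≥0∞}
    (h : ∀ y, P x y ≠ 0 → y ∉ A → g y ≤ g' y) :
    taboo P A g x ≤ taboo P A g' x := by
  refine ENNReal.tsum_le_tsum fun y => ?_
  by_cases hy : P x y = 0
  · simp [hy]
  by_cases hA : y ∈ A
  · simp [hA]
  · rw [Set.indicator_of_mem (by simpa using hA), Set.indicator_of_mem (by simpa using hA)]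
    gcongr
    exact h y hy hA

theorem taboo_add (g g' : X → ℝ≥0∞) (x : X) :
    taboo P A (fun y => g y + g' y) x = taboo P A g x + taboo P A g' x := by
  simp only [taboo]
  rw [← ENNReal.tsum_add]
  refine tsum_congr fun y => ?_
  by_cases hA : y ∈ A <;> simp [hA, mul_add]

theorem taboo_const_mul (c : ℝ≥0∞) (g : X → ℝ≥0∞) (x : X) :
    taboo P A (fun y => c * g y) x = c * taboo P A g x := by
  simp only [taboo]
  rw [← ENNReal.tsum_mul_left]
  refine tsum_congr fun y => ?_
  by_cases hA : y ∈ A <;> simp [hA, mul_left_comm]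

theorem tsum_mul_const (x : X) (c : ℝ≥0∞) : ∑' y, P x y * c = c := by
  rw [ENNReal.tsum_mul_right, (P x).tsum_coe, one_mul]

theorem taboo_const_le (c : ℝ≥0∞) (x : X) : taboo P A (fun _ => c) x ≤ c :=
  (taboo_le_tsum fun _ _ _ => le_rfl).trans (tsum_mul_const x c).le

theorem survival_le_one (n : ℕ) (x : X) : survival P A n x ≤ 1 := by
  induction n generalizing x with
  | zero => exact le_rfl
  | succ n ih => exact (taboo_mono fun y _ _ => ih y).trans (taboo_const_le 1 x)

theorem survival_antitone (x : X) : Antitone fun n => survival P A n x := by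
  refine antitone_nat_of_succ_le fun n => ?_
  induction n generalizing x with
  | zero => exact survival_le_one 1 x
  | succ n ih => exact taboo_mono fun y _ _ => ih y

/-- The mean of the return time truncated at `n`. -/
noncomputable def truncReturnTime (P : X → PMF X) (A : Set X) (n : ℕ) (x : X) : ℝ≥0∞ :=
  ∑ k ∈ Finset.range n, survival P A k x

theorem truncReturnTime_succ (n : ℕ) (x : X) :
    truncReturnTime P A (n + 1) x = 1 + taboo P A (truncReturnTime P A n) x := by
  induction n with
  | zero =>
    have h0 : truncReturnTime P A 0 = fun _ => 0 := funext fun y => by simp [truncReturnTime]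
    simp [h0, truncReturnTime, survival, taboo]
  | succ n ih =>
    rw [truncReturnTime, Finset.sum_range_succ, ← truncReturnTime, ih, add_assoc, survival_succ,
      ← taboo_add]
    congr 2
    funext y
    rw [truncReturnTime, truncReturnTime, Finset.sum_range_succ]

theorem truncReturnTime_mono (x : X) : Monotone fun n => truncReturnTime P A n x :=
  fun _ _ h => Finset.sum_le_sum_of_subset (Finset.range_mono h)

theorem truncReturnTime_le (n : ℕ) (x : X) : truncReturnTime P A n x ≤ n := by
  refine (Finset.sum_le_sum fun k _ => survival_le_one k x).trans ?_
  simp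

theorem meanReturnTime_eq_iSup (x : X) :
    meanReturnTime P A x = ⨆ n, truncReturnTime P A n x :=
  ENNReal.tsum_eq_iSup_nat

theorem meanReturnTime_eq (x : X) :
    meanReturnTime P A x = 1 + taboo P A (meanReturnTime P A) x := by
  have h : taboo P A (meanReturnTime P A) x = ∑' n, survival P A (n + 1) x := by
    simp only [survival_succ, taboo]
    rw [ENNReal.tsum_comm]
    refine tsum_congr fun y => ?_
    rw [ENNReal.tsum_mul_left]
    by_cases hA : y ∈ A <;> simp [hA, meanReturnTime]
  rw [h, meanReturnTime, tsum_eq_zero_add' ENNReal.summable]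
  rfl

/-- Foster's criterion on an absorbing set. -/
theorem meanReturnTime_le_of_drift (hY : Absorbing P Y) (V : X → ℝ≥0∞)
    (hV : ∀ x ∈ Y, x ∉ F → 1 + ∑' y, P x y * V y ≤ V x) {x : X} (hx : x ∈ Y) :
    meanReturnTime P F x ≤ 1 + ∑' y, P x y * V y := by
  rw [meanReturnTime_eq_iSup]
  refine iSup_le fun n => ?_
  induction n generalizing x with
  | zero => simp [truncReturnTime]
  | succ n ih =>
    rw [truncReturnTime_succ]
    gcongr
    exact taboo_le_tsum fun y hy hF => (ih (hY x hx y hy)).trans (hV y (hY x hx y hy) hF)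

theorem survival_eq_one (hY : Absorbing P Y) (hA : ∀ x ∈ Y, x ∉ A) (n : ℕ) {x : X}
    (hx : x ∈ Y) : survival P A n x = 1 := by
  induction n generalizing x with
  | zero => rfl
  | succ n ih =>
    rw [← (P x).tsum_coe]
    refine tsum_congr fun y => ?_
    by_cases hy : P x y = 0
    · simp [hy]
    · have hyY := hY x hx y hy
      rw [Set.indicator_of_mem (by simpa using hA y hyY), ih hyY, mul_one]

theorem exists_mem_of_meanReturnTime_lt_top (hY : Absorbing P Y) {x : X} (hx : x ∈ Y)
    (h : meanReturnTime P F x < ∞) : ∃ z ∈ Y, z ∈ F := by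
  by_contra! hF
  refine h.ne ?_
  simp only [meanReturnTime, survival_eq_one hY hF _ hx]
  exact ENNReal.tsum_const_eq_top_of_ne_zero one_ne_zero

/-! ### From a finite recurrent set to a positive recurrent state -/

/-- The states that never visit `f`, other than `f` itself, form an absorbing set. -/
theorem absorbing_avoiding (hY : Absorbing P Y) (f : X) :
    Absorbing P {x | x ∈ Y ∧ x ≠ f ∧ ∀ n, survival P {f} n x = 1} ∧
      ∀ z ∈ Y, (∀ n, survival P {f} n z = 1) → ∀ y, P z y ≠ 0 →
        y ∈ {x | x ∈ Y ∧ x ≠ f ∧ ∀ n, survival P {f} n x = 1} := by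
  have key : ∀ z ∈ Y, (∀ n, survival P {f} n z = 1) → ∀ y, P z y ≠ 0 →
      y ∈ {x | x ∈ Y ∧ x ≠ f ∧ ∀ n, survival P {f} n x = 1} := by
    intro z hz hs y hy
    have h1 : ∀ n, ({f} : Set X)ᶜ.indicator (survival P {f} n) y = 1 := by
      intro n
      by_contra hne
      have hle : ∀ w, ({f} : Set X)ᶜ.indicator (survival P {f} n) w ≤ 1 := fun w =>
        Set.indicator_apply_le' (fun _ => survival_le_one n w) fun _ => zero_le_one
      -- An average of values at most 1 equals 1 only if every successor of positive probability has
      -- value 1.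
      have hlt : ∑' w, P z w * ({f} : Set X)ᶜ.indicator (survival P {f} n) w < ∑' w, P z w := by
        refine ENNReal.tsum_lt_tsum (i := y) ?_ (fun w => mul_le_of_le_one_right' (hle w)) ?_
        · exact ne_top_of_le_ne_top (by simp [(P z).tsum_coe])
            (ENNReal.tsum_le_tsum fun w => mul_le_of_le_one_right' (hle w) :
              _ ≤ ∑' w, P z w)
        · conv_rhs => rw [← mul_one (P z y)]
          exact ENNReal.mul_lt_mul_right hy ((P z).apply_ne_top y) (lt_of_le_of_ne (hle y) hne)
      rw [(P z).tsum_coe] at hlt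
      exact hlt.ne (hs (n + 1))
    have hyf : y ≠ f := by
      rintro rfl
      simpa using h1 0
    refine ⟨hY z hz y hy, hyf, fun n => ?_⟩
    have := h1 n
    rwa [Set.indicator_of_mem (by simpa using hyf)] at this
  exact ⟨fun x hx => key x hx.1 hx.2.2, key⟩

theorem truncReturnTime_add_le (k n : ℕ) (x : X) :
    truncReturnTime P A (k + n) x ≤ k + (taboo P A)^[k] (truncReturnTime P A n) x := by
  induction k generalizing x with
  | zero => simp
  | succ k ih =>
    rw [Nat.add_right_comm, truncReturnTime_succ, Function.iterate_succ_apply', Nat.cast_succ,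
      add_comm (k : ℝ≥0∞) 1, add_assoc]
    gcongr
    refine (taboo_mono fun y _ _ => ih y).trans ?_
    rw [taboo_add]
    gcongr
    exact taboo_const_le _ x

theorem taboo_iterate_mono (hY : Absorbing P Y) (k : ℕ) {g g' : X → ℝ≥0∞}
    (h : ∀ y ∈ Y, g y ≤ g' y) {x : X} (hx : x ∈ Y) :
    (taboo P A)^[k] g x ≤ (taboo P A)^[k] g' x := by
  induction k generalizing x with
  | zero => exact h x hx
  | succ k ih =>
    rw [Function.iterate_succ_apply', Function.iterate_succ_apply']
    exact taboo_mono fun y hy _ => ih (hY x hx y hy)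

theorem taboo_iterate_add_const (k : ℕ) (g : X → ℝ≥0∞) (c : ℝ≥0∞) (x : X) :
    (taboo P A)^[k] (fun y => g y + c) x = (taboo P A)^[k] g x + c * survival P A k x := by
  induction k generalizing x with
  | zero => simp [survival]
  | succ k ih =>
    rw [Function.iterate_succ_apply', Function.iterate_succ_apply', survival_succ,
      ← taboo_const_mul, ← taboo_add]
    congr 1
    exact funext ih

theorem exists_bound_on_finite (hF : F.Finite) {g : X → ℝ≥0∞} (hg : ∀ z ∈ F, g z < ∞) :
    ∃ c < ∞, ∀ z ∈ F, g z ≤ c := by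
  refine ⟨hF.toFinset.sup g, ?_, fun z hz => Finset.le_sup (hF.mem_toFinset.2 hz)⟩
  rw [Finset.sup_lt_iff ENNReal.zero_lt_top]
  exact fun z hz => hg z (hF.mem_toFinset.1 hz)

/-- To reach `f`, wait for `F` and then pay at most the worst cost from `F`. Truncation keeps that
worst cost finite before any recurrence is known. -/
theorem truncReturnTime_singleton_le (hY : Absorbing P Y) {f : X} {n : ℕ} {M : ℝ≥0∞}
    (hM : ∀ z ∈ F ∩ Y, truncReturnTime P {f} n z ≤ M) {x : X} (hx : x ∈ Y) :
    truncReturnTime P {f} n x ≤ meanReturnTime P F x + M := by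
  suffices h : ∀ m ≤ n, ∀ x ∈ Y, truncReturnTime P {f} m x ≤ meanReturnTime P F x + M from
    h n le_rfl x hx
  intro m
  induction m with
  | zero => simp [truncReturnTime]
  | succ m ih =>
    intro hm x hx
    rw [truncReturnTime_succ, meanReturnTime_eq, add_assoc]
    gcongr
    have h1 : taboo P F (meanReturnTime P F) x + M
        = ∑' y, P x y * (Fᶜ.indicator (meanReturnTime P F) y + M) := by
      simp only [mul_add]
      rw [ENNReal.tsum_add, tsum_mul_const]
      rfl
    rw [h1]
    refine taboo_le_tsum fun y hy _ => ?_
    have hyY := hY x hx y hy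
    by_cases hyF : y ∈ F
    · exact ((truncReturnTime_mono y (Nat.le_of_succ_le hm)).trans (hM y ⟨hyF, hyY⟩)).trans
        le_add_self
    · rw [Set.indicator_of_mem (by simpa using hyF)]
      exact ih (Nat.le_of_succ_le hm) y hyY

/-- If a finite set has finite mean return times and each of its states leads to `f`, then `f` has
finite mean return times. -/
theorem meanReturnTime_singleton_lt_top (hY : Absorbing P Y) (hF : F.Finite)
    (hret : ∀ x ∈ Y, meanReturnTime P F x < ∞) {f : X}
    (hreach : ∀ z ∈ F ∩ Y, ∃ n, survival P {f} n z < 1) {x : X} (hx : x ∈ Y) :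
    meanReturnTime P {f} x < ∞ := by
  classical
  have hFY : (F ∩ Y).Finite := hF.inter_of_left Y
  obtain ⟨c, hc, hcb⟩ := exists_bound_on_finite hFY fun z hz => hret z hz.2
  -- Finiteness gives a common horizon `k` and a failure probability `q < 1`: each trial of `k`
  -- steps from `F` hits `f` with probability at least `1 - q`.
  obtain ⟨k, hk⟩ : ∃ k, ∀ z ∈ F ∩ Y, survival P {f} k z < 1 := by
    choose! n hn using hreach
    refine ⟨hFY.toFinset.sup n, fun z hz => lt_of_le_of_lt ?_ (hn z hz)⟩
    exact survival_antitone z (Finset.le_sup (hFY.mem_toFinset.2 hz))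
  set q := hFY.toFinset.sup (survival P {f} k) with hq
  have hq1 : q < 1 := by
    rw [hq, Finset.sup_lt_iff (by simp)]
    exact fun z hz => hk z (hFY.mem_toFinset.1 hz)
  -- A step outside `F` does not raise the mean time to `F`; a step into `F` restarts it at cost at
  -- most `c`.
  have hstep : ∀ x ∈ Y, taboo P {f} (meanReturnTime P F) x ≤ meanReturnTime P F x + c := by
    intro x hx
    have h1 : taboo P F (meanReturnTime P F) x + c
        = ∑' y, P x y * (Fᶜ.indicator (meanReturnTime P F) y + c) := by
      simp only [mul_add]
      rw [ENNReal.tsum_add, tsum_mul_const]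
      rfl
    have h2 : taboo P F (meanReturnTime P F) x ≤ meanReturnTime P F x := by
      conv_rhs => rw [meanReturnTime_eq]
      exact le_add_self
    refine le_trans ?_ (add_le_add_left h2 c)
    rw [h1]
    refine taboo_le_tsum fun y hy _ => ?_
    by_cases hyF : y ∈ F
    · exact (hcb y ⟨hyF, hY x hx y hy⟩).trans le_add_self
    · rw [Set.indicator_of_mem (by simpa using hyF)]
      exact le_self_add
  have hiter : ∀ j : ℕ, ∀ x ∈ Y,
      (taboo P {f})^[j] (meanReturnTime P F) x ≤ meanReturnTime P F x + j * c := by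
    intro j
    induction j with
    | zero => simp
    | succ j ih =>
      intro x hx
      rw [Function.iterate_succ_apply']
      refine (taboo_mono fun y hy _ => ih y (hY x hx y hy)).trans ?_
      rw [taboo_add]
      refine (add_le_add (hstep x hx) (taboo_const_le _ x)).trans (le_of_eq ?_)
      push_cast
      ring
  set K : ℝ≥0∞ := k + (c + k * c) with hK
  have hKtop : K < ∞ := by
    simp only [hK, ENNReal.add_lt_top]
    exact ⟨ENNReal.natCast_lt_top k, hc, ENNReal.mul_lt_top (ENNReal.natCast_lt_top k) hc⟩
  have hbound : ∀ n, ∀ z ∈ F ∩ Y, truncReturnTime P {f} n z ≤ K / (1 - q) := by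
    intro n
    set M := hFY.toFinset.sup (truncReturnTime P {f} n) with hM
    have hMb : ∀ z ∈ F ∩ Y, truncReturnTime P {f} n z ≤ M := fun z hz =>
      Finset.le_sup (f := truncReturnTime P {f} n) (hFY.mem_toFinset.2 hz)
    have hMtop : M < ∞ := by
      rw [hM, Finset.sup_lt_iff ENNReal.zero_lt_top]
      exact fun z _ => (truncReturnTime_le n z).trans_lt (ENNReal.natCast_lt_top n)
    have hrec : M ≤ K + M * q := by
      refine Finset.sup_le fun z hz => ?_
      have hz' := hFY.mem_toFinset.1 hz
      calc truncReturnTime P {f} n z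
          ≤ truncReturnTime P {f} (k + n) z := truncReturnTime_mono z (Nat.le_add_left n k)
        _ ≤ k + (taboo P {f})^[k] (truncReturnTime P {f} n) z := truncReturnTime_add_le k n z
        _ ≤ k + (taboo P {f})^[k] (fun y => meanReturnTime P F y + M) z := by
            gcongr
            exact taboo_iterate_mono hY k
              (fun y hy => truncReturnTime_singleton_le hY hMb hy) hz'.2
        _ = k + ((taboo P {f})^[k] (meanReturnTime P F) z + M * survival P {f} k z) := by
            rw [taboo_iterate_add_const]
        _ ≤ k + ((c + k * c) + M * q) := by
            gcongr
            · exact (hiter k z hz'.2).trans (add_le_add_left (hcb z hz') _)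
            · exact Finset.le_sup (f := survival P {f} k) hz
        _ = K + M * q := by rw [hK, ← add_assoc]
    intro z hz
    refine (hMb z hz).trans ?_
    rw [ENNReal.le_div_iff_mul_le (Or.inl (tsub_pos_of_lt hq1).ne') (Or.inl (by simp)),
      ENNReal.mul_sub (fun _ _ => hMtop.ne), mul_one]
    exact tsub_le_iff_right.2 hrec
  rw [meanReturnTime_eq_iSup]
  refine lt_of_le_of_lt (iSup_le fun n => truncReturnTime_singleton_le hY (hbound n) hx) ?_
  exact ENNReal.add_lt_top.2 ⟨hret x hx, ENNReal.div_lt_top hKtop.ne (tsub_pos_of_lt hq1).ne'⟩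

/-- An absorbing set with finite mean return times to a finite set contains a positive recurrent
state. -/
theorem exists_positiveRecurrent (hF : F.Finite) (hY : Absorbing P Y) (hne : Y.Nonempty)
    (hret : ∀ x ∈ Y, meanReturnTime P F x < ∞) : ∃ y ∈ Y, y ∈ positiveRecurrentStates P := by
  induction hn : (F ∩ Y).ncard using Nat.strong_induction_on generalizing Y with
  | _ n ih =>
    obtain ⟨x, hx⟩ := hne
    obtain ⟨f, hfY, hfF⟩ := exists_mem_of_meanReturnTime_lt_top hY hx (hret x hx)
    by_cases hreach : ∀ z ∈ F ∩ Y, ∃ n, survival P {f} n z < 1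
    · exact ⟨f, hfY, meanReturnTime_singleton_lt_top hY hF hret hreach hfY⟩
    · push Not at hreach
      obtain ⟨z, hz, hzs⟩ := hreach
      obtain ⟨habs, hmem⟩ := absorbing_avoiding hY f
      obtain ⟨y, hy⟩ := (P z).support_nonempty
      have hcard : (F ∩ {x | x ∈ Y ∧ x ≠ f ∧ ∀ n, survival P {f} n x = 1}).ncard < n := by
        rw [← hn]
        refine Set.ncard_lt_ncard ⟨fun w hw => ⟨hw.1, hw.2.1⟩, fun h => ?_⟩
          (hF.inter_of_left Y)
        exact (h ⟨hfF, hfY⟩).2.2.1 rfl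
      obtain ⟨w, hw, hwR⟩ := ih _ hcard habs
        ⟨y, hmem z hz.2 (fun n => le_antisymm (survival_le_one n z) (hzs n)) y hy⟩
        (fun w hw => hret w hw.1) rfl
      exact ⟨w, hw.1, hwR⟩

/-! ### Almost sure entry into the positive recurrent states -/

theorem iInf_survival_le (x : X) :
    ⨅ n, survival P A n x ≤ taboo P A (fun y => ⨅ n, survival P A n y) x := by
  -- The sum is read as an integral against counting measure, so that monotone convergence exchanges
  -- it with the decreasing limit.
  let _ : MeasurableSpace X := ⊤
  have hmeas : ∀ n, Measurable fun y => P x y * Aᶜ.indicator (survival P A n) y :=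
    fun n => measurable_from_top
  have hanti : Antitone fun n y => P x y * Aᶜ.indicator (survival P A n) y := by
    intro m n hmn y
    refine mul_le_mul_right (Set.indicator_le_indicator ?_) _
    exact survival_antitone y hmn
  have hfin : ∫⁻ y, P x y * Aᶜ.indicator (survival P A 0) y ∂MeasureTheory.Measure.count ≠ ∞ := by
    rw [MeasureTheory.lintegral_count]
    exact ((survival_le_one 1 x).trans_lt ENNReal.one_lt_top).ne
  have h := MeasureTheory.lintegral_iInf (μ := MeasureTheory.Measure.count) hmeas hanti hfin
  simp only [MeasureTheory.lintegral_count] at h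
  have h2 : taboo P A (fun y => ⨅ n, survival P A n y) x
      = ∑' y, ⨅ n, P x y * Aᶜ.indicator (survival P A n) y := by
    refine tsum_congr fun y => ?_
    rw [← ENNReal.mul_iInf fun h => absurd h ((P x).apply_ne_top y)]
    by_cases hA : y ∈ A <;> simp [hA]
  rw [h2, h]
  exact le_iInf fun n => iInf_le (fun n => survival P A n x) (n + 1)

/-- A chain is stable if every initial state lies in an absorbing set with finite mean return times
to some finite set. -/
theorem isStable_of_finite_meanReturnTime
    (h : ∀ x, ∃ Y F : Set X, x ∈ Y ∧ Absorbing P Y ∧ F.Finite ∧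
      ∀ y ∈ Y, meanReturnTime P F y < ∞) : IsStable P := by
  classical
  intro x₀
  obtain ⟨Y, F, hx₀, hY, hF, hret⟩ := h x₀
  set R := positiveRecurrentStates P with hR
  set s : X → ℝ≥0∞ := fun x => ⨅ n, survival P R n x with hs
  have hsT : ∀ x, s x ≤ taboo P R s x := fun x => iInf_survival_le x
  have hs1 : ∀ x, s x ≤ 1 := fun x => iInf_le (fun n => survival P R n x) 0
  suffices hzero : s x₀ = 0 by
    rw [← hzero]
    exact tendsto_atTop_iInf (survival_antitone x₀)
  have hfin : ((F ∩ Y) \ R).Finite := (hF.inter_of_left Y).sdiff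
  set m := hfin.toFinset.sup s with hm
  have hle : ∀ x ∈ Y, s x ≤ m := by
    -- Either `F` has not been visited by time `n`, or the probability `s` of never meeting `R` is
    -- at most `m` from the point of entry.
    have hn : ∀ n, ∀ x ∈ Y, s x ≤ survival P F n x + m := by
      intro n
      induction n with
      | zero => exact fun x _ => (hs1 x).trans le_self_add
      | succ n ih =>
        intro x hx
        have h1 : survival P F (n + 1) x + m
            = ∑' y, P x y * (Fᶜ.indicator (survival P F n) y + m) := by
          simp only [mul_add]
          rw [ENNReal.tsum_add, tsum_mul_const]
          rfl
        rw [h1]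
        refine (hsT x).trans (taboo_le_tsum fun y hy hyR => ?_)
        have hyY := hY x hx y hy
        by_cases hyF : y ∈ F
        · exact (Finset.le_sup (f := s) (hfin.mem_toFinset.2 ⟨⟨hyF, hyY⟩, hyR⟩)).trans
            le_add_self
        · rw [Set.indicator_of_mem (by simpa using hyF)]
          exact ih y hyY
    intro x hx
    have ht : Filter.Tendsto (fun n => survival P F n x + m) Filter.atTop (𝓝 (0 + m)) :=
      (ENNReal.tendsto_atTop_zero_of_tsum_ne_top (hret x hx).ne).add tendsto_const_nhds
    rw [zero_add] at ht
    exact ge_of_tendsto' ht fun n => hn n x hx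
  by_contra hpos
  have hm0 : m ≠ 0 := fun h0 => hpos (le_antisymm ((hle x₀ hx₀).trans h0.le) zero_le)
  have hne : hfin.toFinset.Nonempty := by
    rw [Finset.nonempty_iff_ne_empty]
    intro he
    exact hm0 (by rw [hm, he]; rfl)
  obtain ⟨y, hy, hym⟩ := Finset.exists_mem_eq_sup _ hne s
  obtain ⟨⟨-, hyY⟩, hyR⟩ := hfin.mem_toFinset.1 hy
  have hm1 : m ≠ ∞ := ((hle y hyY).antisymm (hm ▸ hym.le) ▸
    ((hs1 y).trans_lt ENNReal.one_lt_top).ne)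
  -- Maximum principle: `s` is at most its one-step average over successors outside `R`, so a state
  -- attaining the maximum `m > 0` leads only to such states.
  have hC : Absorbing P {z | z ∈ Y ∧ z ∉ R ∧ s z = m} := by
    rintro z ⟨hzY, -, hzm⟩ w hw
    have hbd : ∀ v, P z v * Rᶜ.indicator s v ≤ P z v * m := by
      intro v
      by_cases hv : P z v = 0
      · simp [hv]
      · gcongr
        exact Set.indicator_apply_le' (fun _ => hle v (hY z hzY v hv)) fun _ => zero_le
    have heq : Rᶜ.indicator s w = m := by
      by_contra hne
      have hwm : Rᶜ.indicator s w ≤ m :=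
        Set.indicator_apply_le' (fun _ => hle w (hY z hzY w hw)) fun _ => zero_le
      have hlt : ∑' v, P z v * Rᶜ.indicator s v < ∑' v, P z v * m := by
        refine ENNReal.tsum_lt_tsum (i := w) ?_ hbd
          (ENNReal.mul_lt_mul_right hw ((P z).apply_ne_top w) (lt_of_le_of_ne hwm hne))
        refine ne_top_of_le_ne_top ?_ (ENNReal.tsum_le_tsum hbd)
        rwa [tsum_mul_const]
      rw [tsum_mul_const] at hlt
      exact (hzm ▸ (hsT z).trans_lt hlt).ne rfl
    have hwR : w ∉ R := by
      intro hwR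
      rw [Set.indicator_of_notMem (by simpa using hwR)] at heq
      exact hm0 heq.symm
    rw [Set.indicator_of_mem (by simpa using hwR)] at heq
    exact ⟨hY z hzY w hw, hwR, heq⟩
  obtain ⟨z, hz, hzR⟩ := exists_positiveRecurrent hF hC ⟨y, hyY, hyR, hym.symm⟩
    fun z hz => hret z hz.1
  exact hz.2.1 hzR

end MarkovChain

/-! ### Arrivals and one-step transitions -/

theorem PMF.tsum_map_mul {α β : Type*} (p : PMF α) (f : α → β) (g : β → ℝ≥0∞) :
    ∑' b, p.map f b * g b = ∑' a, p a * g (f a) := by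
  classical
  simp only [PMF.map_apply, ← ENNReal.tsum_mul_right]
  rw [ENNReal.tsum_comm]
  refine tsum_congr fun a => ?_
  rw [tsum_eq_single (f a) fun b hb => by simp [hb]]
  simp

namespace Polling

variable {N : ℕ}

theorem State.backlog_incumbent (x : State N) :
    x.backlog x.info.incumbent = x.info.obs x.info.incumbent := by
  have h1 := x.obs_le x.info.incumbent
  have h2 := x.le_obs_add_age x.info.incumbent
  rw [(x.info.age_eq_zero_iff _).2 rfl] at h2
  omega

theorem sum_arrivals_mul_indicator (lam : capacityRegion N) (j : Fin N) :
    ∑ a, arrivals lam a * (if a j = true then 1 else 0) = lam.1 j := by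
  -- Independence: the indicator is absorbed into the `j`-th factor, and every other factor sums to
  -- 1.
  have h := Finset.prod_univ_sum (fun _ : Fin N => (Finset.univ : Finset Bool))
    (fun i b => (if b then (lam.1 i : ℝ≥0∞) else ((1 - lam.1 i : ℝ≥0) : ℝ≥0∞)) *
      (if i = j then (if b = true then 1 else 0) else 1))
  rw [Fintype.piFinset_univ] at h
  have hl : ∀ a : Fin N → Bool, arrivals lam a * (if a j = true then 1 else 0)
      = ∏ i, (if a i then (lam.1 i : ℝ≥0∞) else ((1 - lam.1 i : ℝ≥0) : ℝ≥0∞)) *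
        (if i = j then (if a i = true then 1 else 0) else 1) := by
    intro a
    rw [Finset.prod_mul_distrib, Finset.prod_ite_eq' Finset.univ j]
    simp [arrivals, PMF.ofFintype_apply]
  rw [Finset.sum_congr rfl fun a _ => hl a, ← h, Finset.prod_eq_single j]
  · simp
  · intro i _ hij
    have := add_tsub_cancel_of_le (capacityRegion.le_one lam i)
    simp only [Fintype.sum_bool, hij, if_true, if_false, Bool.false_eq_true, mul_one]
    exact_mod_cast this
  · simp

/-- The mean number of arrivals at a slot boundary. -/
theorem sum_arrivals_mul_card (lam : capacityRegion N) :
    ∑ a, arrivals lam a * ((∑ j, if a j = true then 1 else 0 : ℕ) : ℝ≥0∞)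
      = ((∑ j, lam.1 j : ℝ≥0) : ℝ≥0∞) := by
  push_cast
  simp only [Finset.mul_sum]
  rw [Finset.sum_comm]
  exact Finset.sum_congr rfl fun j _ => sum_arrivals_mul_indicator lam j

theorem sum_arrivals (lam : capacityRegion N) : ∑ a, arrivals lam a = 1 := by
  rw [← tsum_fintype (L := .unconditional _)]
  exact (arrivals lam).tsum_coe

theorem arrivals_false_ne_zero (lam : capacityRegion N) : arrivals lam (fun _ => false) ≠ 0 := by
  simp only [arrivals, PMF.ofFintype_apply, Bool.false_eq_true, if_false]
  refine Finset.prod_ne_zero_iff.2 fun j _ => ?_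
  have : lam.1 j < 1 :=
    (Finset.single_le_sum (f := lam.1) (fun _ _ => zero_le) (Finset.mem_univ j)).trans_lt lam.2
  exact_mod_cast (tsub_pos_of_lt this).ne'

theorem exists_eq_next {lam : capacityRegion N} {φ : Policy N} {x y : State N}
    (h : transition lam φ x y ≠ 0) : ∃ a, y = x.next (φ x.info) a := by
  obtain ⟨a, -, ha⟩ := (PMF.mem_support_map_iff _ _ _).1 ((PMF.mem_support_iff _ _).2 h)
  exact ⟨a, ha.symm⟩

/-! ### Lyapunov drift of the polling system -/

/-- The states in which the queues other than the incumbent were last observed with at most `B`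
packets. -/
def observedAtMost (N B : ℕ) : Set (State N) :=
  {x | ∀ j, j ≠ x.info.incumbent → x.info.obs j ≤ B}

/-- Exhaustiveness ensures that a queue just abandoned was last observed empty; the other records
are unchanged. -/
theorem absorbing_observedAtMost (lam : capacityRegion N) {φ : Policy N} (hφ : IsExhaustive φ)
    (B : ℕ) : MarkovChain.Absorbing (transition lam φ) (observedAtMost N B) := by
  intro x hx y hy j hj
  obtain ⟨a, rfl⟩ := exists_eq_next hy
  have hj' : j ≠ (φ x.info).queue := hj
  simp only [State.next, hj', if_false]
  by_cases hinc : j = x.info.incumbent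
  · by_contra hlt
    refine hj' ?_
    rw [hφ x.info (by rw [← hinc]; omega), hinc]
  · exact hx j hinc

/-- A true backlog exceeds its last observation by at most the age, so all components of the state
are bounded. -/
theorem finite_bounded (N B L : ℕ) :
    {x : State N | x ∈ observedAtMost N B ∧ x.info.obs x.info.incumbent = 0 ∧
      ∀ j, x.info.age j ≤ L}.Finite := by
  have hinj : Function.Injective
      (fun x : State N => (x.backlog, x.info.incumbent, x.info.age, x.info.obs)) := by
    rintro ⟨b, ⟨i, v, o, h1⟩, h2, h3⟩ ⟨b', ⟨i', v', o', h1'⟩, h2', h3'⟩ h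
    simp only [Prod.mk.injEq] at h
    obtain ⟨rfl, rfl, rfl, rfl⟩ := h
    rfl
  refine Set.Finite.subset (((Set.finite_Iic (fun _ : Fin N => B + L)).prod
    (Set.finite_univ.prod ((Set.finite_Iic (fun _ : Fin N => L)).prod
      (Set.finite_Iic (fun _ : Fin N => B))))).preimage hinj.injOn) ?_
  rintro x ⟨hB, h0, hL⟩
  have hobs : ∀ j, x.info.obs j ≤ B := by
    intro j
    by_cases hj : j = x.info.incumbent
    · rw [hj, h0]
      exact Nat.zero_le B
    · exact hB j hj
  exact ⟨fun j => (x.le_obs_add_age j).trans (add_le_add (hobs j) (hL j)), Set.mem_univ _,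
    hL, hobs⟩

/-- Total backlog, weighted by `L`, plus the total of the ages truncated at `L`. -/
def potential (L : ℕ) (x : State N) : ℕ :=
  L * ∑ j, x.backlog j + ∑ j, min (x.info.age j) L

theorem potential_next_add_le (L : ℕ) (x : State N) (u : Action N) (a : Fin N → Bool)
    (hserve : u.serve = true) (hu : 0 < x.backlog u.queue ∨ L ≤ x.info.age u.queue) :
    potential L (x.next u a) + L
      ≤ potential L x + N + L * ∑ j, (if a j = true then 1 else 0) := by
  have hb : ∀ j, (x.next u a).backlog j + (if j = u.queue ∧ 0 < x.backlog u.queue then 1 else 0)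
      = x.backlog j + if a j = true then 1 else 0 := by
    intro j
    simp only [State.next, nextBacklog, hserve, true_and]
    by_cases hj : j = u.queue
    · subst hj
      by_cases h0 : 0 < x.backlog u.queue <;> simp only [h0, and_true, if_true, and_false, if_false]
        <;> omega
    · simp [hj]
  have hv : ∀ j, min ((x.next u a).info.age j) L
        + (if j = u.queue ∧ L ≤ x.info.age u.queue then L else 0)
      ≤ min (x.info.age j) L + 1 := by
    intro j
    simp only [State.next]
    by_cases hj : j = u.queue
    · subst hj
      by_cases h0 : L ≤ x.info.age u.queue <;> simp [h0]
    · simp only [hj, false_and, if_false]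
      omega
  have hbs := Finset.sum_congr rfl fun j (_ : j ∈ Finset.univ) => hb j
  have hvs := Finset.sum_le_sum fun j (_ : j ∈ Finset.univ) => hv j
  simp only [Finset.sum_add_distrib, Finset.sum_const, Finset.card_univ, Fintype.card_fin,
    smul_eq_mul, mul_one] at hbs hvs
  simp only [potential]
  have hbL := congrArg (L * ·) hbs
  simp only [mul_add] at hbL
  rcases hu with h | h
  · simp only [h, and_true, Finset.sum_ite_eq', Finset.mem_univ, if_true, mul_one] at hbL
    omega
  · simp only [h, and_true, Finset.sum_ite_eq', Finset.mem_univ, if_true] at hvs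
    omega

theorem drift {lam : capacityRegion N} {φ : Policy N} {L : ℕ}
    (hL : (N : ℝ≥0) + 1 + L * ∑ j, lam.1 j ≤ L) {x : State N} (hserve : (φ x.info).serve = true)
    (hu : 0 < x.backlog (φ x.info).queue ∨ L ≤ x.info.age (φ x.info).queue) :
    1 + ∑' y, transition lam φ x y * (potential L y : ℝ≥0∞) ≤ potential L x := by
  set ρ : ℝ≥0 := ∑ j, lam.1 j with hρ
  have hL' : (N : ℝ≥0∞) + 1 + L * (ρ : ℝ≥0∞) ≤ L := by exact_mod_cast hL
  rw [transition, PMF.tsum_map_mul, tsum_fintype]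
  set E := ∑ a, arrivals lam a * (potential L (x.next (φ x.info) a) : ℝ≥0∞) with hE
  have h : E + L ≤ potential L x + N + L * (ρ : ℝ≥0∞) := by
    calc E + L = ∑ a, arrivals lam a *
          ((potential L (x.next (φ x.info) a) + L : ℕ) : ℝ≥0∞) := by
          push_cast
          simp only [mul_add]
          rw [Finset.sum_add_distrib, ← Finset.sum_mul, sum_arrivals, one_mul]
      _ ≤ ∑ a, arrivals lam a *
          ((potential L x + N + L * ∑ j, (if a j = true then 1 else 0) : ℕ) : ℝ≥0∞) := by
          refine Finset.sum_le_sum fun a _ => mul_le_mul_right (Nat.cast_le.2 ?_) _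
          exact potential_next_add_le L x _ a hserve hu
      _ = potential L x + N + L * (ρ : ℝ≥0∞) := by
          rw [hρ, ← sum_arrivals_mul_card, Finset.mul_sum]
          conv_rhs => rw [← one_mul ((potential L x : ℝ≥0∞) + N), ← sum_arrivals lam,
            Finset.sum_mul, ← Finset.sum_add_distrib]
          refine Finset.sum_congr rfl fun a _ => ?_
          push_cast
          ring
  have hfin : (N : ℝ≥0∞) + L * (ρ : ℝ≥0∞) ≠ ∞ := by
    exact_mod_cast ENNReal.coe_ne_top (r := (N : ℝ≥0) + L * ρ)
  -- Adding a finite constant to both sides avoids truncated subtraction.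
  refine (ENNReal.add_le_add_iff_right hfin).1 ?_
  calc 1 + E + (N + L * (ρ : ℝ≥0∞)) = E + (N + 1 + L * (ρ : ℝ≥0∞)) := by ring
    _ ≤ E + L := by gcongr
    _ ≤ _ := h
    _ = _ := by ring

theorem exists_large_level (lam : capacityRegion N) (M : ℕ) :
    ∃ L : ℕ, M ≤ L ∧ (N : ℝ≥0) + 1 + L * ∑ j, lam.1 j ≤ L := by
  have hρ : ∑ j, lam.1 j < 1 := lam.2
  set ρ := ∑ j, lam.1 j
  -- The condition is `N + 1 ≤ L * (1 - ρ)`, which persists when `L` grows.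
  obtain ⟨K, hK⟩ := exists_nat_ge (((N : ℝ≥0) + 1) / (1 - ρ))
  refine ⟨max M K, le_max_left _ _, ?_⟩
  have hpos : 0 < 1 - ρ := tsub_pos_of_lt hρ
  have h1 : (N : ℝ≥0) + 1 ≤ (max M K : ℕ) * (1 - ρ) := by
    rw [← div_le_iff₀ hpos]
    exact hK.trans (by exact_mod_cast le_max_right M K)
  calc (N : ℝ≥0) + 1 + (max M K : ℕ) * ρ ≤ (max M K : ℕ) * (1 - ρ) + (max M K : ℕ) * ρ := by gcongr
    _ = (max M K : ℕ) := by rw [← mul_add, tsub_add_cancel_of_le hρ.le, mul_one]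

theorem IsGreedy.serve_eq_true {φ : Policy N} (hg : IsGreedy φ) (he : IsExhaustive φ) {i : Info N}
    (h : 0 < i.obs i.incumbent) : (φ i).serve = true := by
  by_contra hs
  exact hg i h ⟨he i h, by simpa using hs⟩

/-- A greedy exhaustive policy that deviates from cyclic exhaustive service at finitely many age
vectors is throughput optimal. -/
theorem isThroughputOptimal_of_finite_deviationSet {πs φ : Policy N} (hπ : IsCyclicExhaustive πs)
    (hg : IsGreedy φ) (he : IsExhaustive φ) (hfin : (deviationSet φ πs).Finite) :
    IsThroughputOptimal φ := by
  intro lam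
  obtain ⟨w, hw⟩ := hfin.bddAbove
  obtain ⟨L, hML, hL⟩ := exists_large_level lam (Finset.univ.sup w)
  refine MarkovChain.isStable_of_finite_meanReturnTime fun x₀ => ?_
  have habs := absorbing_observedAtMost lam he (Finset.univ.sup x₀.info.obs)
  refine ⟨observedAtMost N (Finset.univ.sup x₀.info.obs), _,
    fun j _ => Finset.le_sup (f := x₀.info.obs) (Finset.mem_univ j), habs, finite_bounded N (Finset.univ.sup x₀.info.obs) L, ?_⟩
  intro y hy
  refine (MarkovChain.meanReturnTime_le_of_drift habs (fun x => (potential L x : ℝ≥0∞)) ?_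
    hy).trans_lt ?_
  · intro x hx hxF
    by_cases h0 : 0 < x.info.obs x.info.incumbent
    · refine drift hL (hg.serve_eq_true he h0) (Or.inl ?_)
      rwa [he _ h0, x.backlog_incumbent]
    · have h0' : x.info.obs x.info.incumbent = 0 := by omega
      -- An age above `L` exceeds every age at which `φ` deviates, so `φ` acts cyclically here and
      -- picks a queue at least that old.
      obtain ⟨j, hj⟩ : ∃ j, L < x.info.age j := by
        by_contra! hall
        exact hxF ⟨hx, h0', hall⟩
      have heq : φ x.info = πs x.info := by
        by_contra hne
        have h1 : x.info.age j ≤ w j := hw ⟨x.info, rfl, hne⟩ j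
        have h2 : w j ≤ Finset.univ.sup w := Finset.le_sup (Finset.mem_univ j)
        omega
      obtain ⟨hs, hmax⟩ := hπ.2.2 x.info h0'
      rw [← heq] at hs hmax
      exact drift hL hs (Or.inr (hj.le.trans (hmax j)))
  -- Each state has finitely many successors, so the Foster bound is finite even from the
  -- exceptional set.
  · rw [transition, PMF.tsum_map_mul, tsum_fintype]
    refine ENNReal.add_lt_top.2 ⟨ENNReal.one_lt_top, ENNReal.sum_lt_top.2 fun a _ => ?_⟩
    exact ENNReal.mul_lt_top ((arrivals lam).apply_lt_top a) (ENNReal.natCast_lt_top _)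

/-! ### Lingering policies -/

theorem exists_oldest (i : Info N) : ∃ k, ∀ j, i.age j ≤ i.age k :=
  have : Nonempty (Fin N) := ⟨i.incumbent⟩
  Finite.exists_max i.age

open Classical in
/-- The policy that stays at an empty incumbent while all ages are at most `m`, and otherwise
follows cyclic exhaustive service. -/
noncomputable def lingering (N m : ℕ) : Policy N := fun i =>
  ⟨if 0 < i.obs i.incumbent ∨ ∀ j, i.age j ≤ m then i.incumbent else (exists_oldest i).choose, true⟩

theorem lingering_of_obs_pos {m : ℕ} {i : Info N} (h : 0 < i.obs i.incumbent) :
    (lingering N m i).queue = i.incumbent := if_pos (Or.inl h)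

theorem lingering_of_age_le {m : ℕ} {i : Info N} (h : ∀ j, i.age j ≤ m) :
    (lingering N m i).queue = i.incumbent := if_pos (Or.inr h)

theorem isGreedy_lingering (m : ℕ) : IsGreedy (lingering N m) :=
  fun _ _ h => Bool.false_ne_true h.2.symm

theorem isExhaustive_lingering (m : ℕ) : IsExhaustive (lingering N m) :=
  fun _ h => lingering_of_obs_pos h

theorem age_le_lingering {m : ℕ} {i : Info N} (h0 : i.obs i.incumbent = 0) {k : Fin N}
    (hk : m < i.age k) (j : Fin N) : i.age j ≤ i.age (lingering N m i).queue := by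
  have : (lingering N m i).queue = (exists_oldest i).choose := by
    refine if_neg ?_
    push Not
    exact ⟨h0.le, k, hk⟩
  rw [this]
  exact (exists_oldest i).choose_spec j

/-- With threshold 0, lingering occurs only when all ages vanish, where the incumbent is trivially
oldest. -/
theorem isCyclicExhaustive_lingering_zero : IsCyclicExhaustive (lingering N 0) := by
  refine ⟨isGreedy_lingering 0, isExhaustive_lingering 0, fun i h0 => ⟨rfl, fun j => ?_⟩⟩
  by_cases h : ∃ k, 0 < i.age k
  · obtain ⟨k, hk⟩ := h
    exact age_le_lingering h0 hk j
  · push Not at h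
    exact (h j).trans (Nat.zero_le _)

theorem isThroughputOptimal_lingering (m : ℕ) : IsThroughputOptimal (lingering N m) := by
  refine isThroughputOptimal_of_finite_deviationSet isCyclicExhaustive_lingering_zero
    (isGreedy_lingering m) (isExhaustive_lingering m)
    ((Set.finite_Iic (fun _ : Fin N => m)).subset ?_)
  rintro v ⟨i, rfl, hne⟩
  by_contra hv
  refine hne ?_
  obtain ⟨k, hk⟩ : ∃ k, m < i.age k := by
    by_contra! h
    exact hv h
  have h1 : ¬ ∀ j, i.age j ≤ m := fun h => (h k).not_gt hk
  have h2 : ¬ ∀ j, i.age j ≤ 0 := fun h => by have := h k; omega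
  simp only [lingering, h1, h2]

/-! ### Distinguishing the laws of lingering policies -/

theorem mem_support_law_succ {lam : capacityRegion N} {φ : Policy N} {x y : State N} {t : ℕ} :
    y ∈ (MarkovChain.law (transition lam φ) x (t + 1)).support ↔
      ∃ z ∈ (MarkovChain.law (transition lam φ) x t).support,
        ∃ a ∈ (arrivals lam).support, z.next (φ z.info) a = y := by
  simp only [MarkovChain.law, PMF.mem_support_bind_iff, transition, PMF.mem_support_map_iff]

/-- Until the largest age exceeds `m`, the lingering policy stays at the initial incumbent. -/
theorem lingering_stays {lam : capacityRegion N} {m t : ℕ} {x : State N}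
    (ht : Finset.univ.sup x.info.age + t ≤ m + 1) {y : State N}
    (hy : y ∈ (MarkovChain.law (transition lam (lingering N m)) x t).support) :
    y.info.incumbent = x.info.incumbent ∧
      ∀ j, j ≠ x.info.incumbent → y.info.age j = x.info.age j + t := by
  induction t generalizing y with
  | zero =>
    obtain rfl : y = x := by simpa [MarkovChain.law] using hy
    exact ⟨rfl, fun _ _ => rfl⟩
  | succ t ih =>
    obtain ⟨z, hz, a, -, rfl⟩ := mem_support_law_succ.1 hy
    obtain ⟨hinc, hage⟩ := ih (by omega) hz
    have hq : (lingering N m z.info).queue = x.info.incumbent := by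
      rw [lingering_of_age_le, hinc]
      intro j
      by_cases hj : j = x.info.incumbent
      · rw [(z.info.age_eq_zero_iff j).2 (hj.trans hinc.symm)]
        exact Nat.zero_le m
      · have h1 : x.info.age j ≤ Finset.univ.sup x.info.age := Finset.le_sup (Finset.mem_univ j)
        rw [hage j hj]
        omega
    refine ⟨hq, fun j hj => ?_⟩
    simp only [State.next, hq, hj, if_false, hage j hj]
    omega

/-- As long as it stays, the lingering policy may drain the initial incumbent without
interference by arrivals. -/
theorem exists_drained {lam : capacityRegion N} {m t : ℕ} {x : State N}
    (ht : Finset.univ.sup x.info.age + t ≤ m + 1) :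
    ∃ y ∈ (MarkovChain.law (transition lam (lingering N m)) x t).support,
      y.backlog x.info.incumbent = x.backlog x.info.incumbent - t := by
  induction t with
  | zero => exact ⟨x, by simp [MarkovChain.law], rfl⟩
  | succ t ih =>
    obtain ⟨z, hz, hb⟩ := ih (by omega)
    have hy := mem_support_law_succ.2
      ⟨z, hz, _, (PMF.mem_support_iff _ _).2 (arrivals_false_ne_zero lam), rfl⟩
    refine ⟨_, hy, ?_⟩
    have hq : (lingering N m z.info).queue = x.info.incumbent := (lingering_stays ht hy).1
    have hs : (lingering N m z.info).serve = true := rfl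
    simp only [State.next, nextBacklog, hq, hs, hb]
    simp
    omega

/-- When the largest age exceeds `m`, the lingering policy leaves the initial incumbent with
positive probability. -/
theorem exists_departed (hN : 2 ≤ N) {lam : capacityRegion N} {m t : ℕ} {x : State N}
    (ht : Finset.univ.sup x.info.age + t = m + 1) (hb : x.backlog x.info.incumbent ≤ t) :
    ∃ y ∈ (MarkovChain.law (transition lam (lingering N m)) x (t + 1)).support,
      y.info.incumbent ≠ x.info.incumbent := by
  obtain ⟨z, hz, hzb⟩ := exists_drained (lam := lam) ht.le
  obtain ⟨hinc, hage⟩ := lingering_stays ht.le hz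
  refine ⟨_, mem_support_law_succ.2
      ⟨z, hz, _, (PMF.mem_support_iff _ _).2 (arrivals_false_ne_zero lam), rfl⟩, ?_⟩
  have h0 : z.info.obs z.info.incumbent = 0 := by
    rw [← z.backlog_incumbent, hinc]
    omega
  -- A second queue has positive age, so the oldest queue is not the incumbent and its age has grown
  -- to `m + 1` by time `t`.
  have : Nontrivial (Fin N) := Fin.nontrivial_iff_two_le.2 hN
  obtain ⟨j, hj⟩ := exists_ne x.info.incumbent
  have hjpos : 0 < x.info.age j := Nat.pos_of_ne_zero fun h => hj ((x.info.age_eq_zero_iff j).1 h)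
  obtain ⟨k, -, hk⟩ := Finset.exists_mem_eq_sup Finset.univ ⟨j, Finset.mem_univ j⟩ x.info.age
  have hjk : x.info.age j ≤ x.info.age k := hk ▸ Finset.le_sup (Finset.mem_univ j)
  have hkx : k ≠ x.info.incumbent := fun h => by
    rw [(x.info.age_eq_zero_iff k).2 h] at hjk
    omega
  have hkz : m < z.info.age k := by
    rw [hage k hkx]
    omega
  have hle := age_le_lingering h0 hkz k
  intro h
  have h' : (lingering N m z.info).queue = z.info.incumbent := h.trans hinc.symm
  rw [h', (z.info.age_eq_zero_iff _).2 rfl] at hle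
  omega

theorem infinite_laws (hN : 2 ≤ N) (lam : capacityRegion N) (x : State N) :
    {p : ℕ → PMF (State N) | ∃ φ : Policy N, IsGreedy φ ∧ IsExhaustive φ ∧
      IsThroughputOptimal φ ∧ p = MarkovChain.law (transition lam φ) x}.Infinite := by
  set A := Finset.univ.sup x.info.age
  set b := x.backlog x.info.incumbent
  set f : ℕ → ℕ → PMF (State N) := fun n =>
    MarkovChain.law (transition lam (lingering N (A + b + n))) x with hf
  suffices hne : ∀ n n', n < n' → f n ≠ f n' by
    refine Set.infinite_of_injective_forall_mem (f := f) (fun n n' heq => ?_) fun n =>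
      ⟨_, isGreedy_lingering _, isExhaustive_lingering _, isThroughputOptimal_lingering _, rfl⟩
    rcases lt_trichotomy n n' with h | h | h
    · exact absurd heq (hne _ _ h)
    · exact h
    · exact absurd heq.symm (hne _ _ h)
  intro n n' hlt heq
  -- The offset `A + b` in the threshold leaves time to drain the initial backlog `b`. At time `t =
  -- b + n + 1` the oldest age passes the smaller threshold, so a departure can be seen at `t + 1`;
  -- the larger threshold still forbids it.
  obtain ⟨y, hy, hne⟩ := exists_departed hN (lam := lam) (m := A + b + n) (t := b + n + 1) (x := x)
    (by omega) (by omega)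
  have heq' := congrFun heq (b + n + 1 + 1)
  simp only [hf] at heq'
  rw [heq'] at hy
  exact hne (lingering_stays (by omega) hy).1

theorem nontrivial_throughputOptimal (hN : 2 ≤ N) :
    {φ : Policy N | IsThroughputOptimal φ}.Nontrivial := by
  let x : State N :=
    { backlog := fun _ => 0
      info :=
        { incumbent := ⟨0, by omega⟩
          age := fun j => if j = ⟨0, by omega⟩ then 0 else 1
          obs := fun _ => 0
          age_eq_zero_iff := fun j => by simp }
      obs_le := fun _ => le_rfl
      le_obs_add_age := fun _ => Nat.zero_le _ }
  let lam : capacityRegion N := ⟨0, by simp [capacityRegion]⟩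
  obtain ⟨_, ⟨φ, _, _, hφ, rfl⟩, _, ⟨ψ, _, _, hψ, rfl⟩, hne⟩ := (infinite_laws hN lam x).nontrivial
  exact ⟨φ, hφ, ψ, hψ, fun h => hne (by rw [h])⟩

end Polling

theorem mainTheorem6 (N : ℕ) :
    (∃ πs : Polling.Policy N,
      Polling.IsCyclicExhaustive πs ∧ Polling.IsThroughputOptimal πs) ∧
    (∀ πs φ : Polling.Policy N, Polling.IsCyclicExhaustive πs →
      Polling.IsGreedy φ → Polling.IsExhaustive φ → (Polling.deviationSet φ πs).Finite →
      Polling.IsThroughputOptimal φ) ∧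
    (2 ≤ N →
      {φ : Polling.Policy N | Polling.IsThroughputOptimal φ}.Nontrivial ∧
      ∀ (lam : Polling.capacityRegion N) (x : Polling.State N),
        {p : ℕ → PMF (Polling.State N) | ∃ φ : Polling.Policy N,
          Polling.IsGreedy φ ∧ Polling.IsExhaustive φ ∧ Polling.IsThroughputOptimal φ ∧
          p = MarkovChain.law (Polling.transition lam φ) x}.Infinite) :=
  ⟨⟨_, Polling.isCyclicExhaustive_lingering_zero, Polling.isThroughputOptimal_lingering 0⟩,
    fun _ _ hπ hg he hfin => Polling.isThroughputOptimal_of_finite_deviationSet hπ hg he hfin,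
    fun hN => ⟨Polling.nontrivial_throughputOptimal hN, Polling.infinite_laws hN⟩⟩
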